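/- For integers $r,k$ let $\binom{r}{k}=\frac{r(r-1)\cdots(r-k+1)}{k!}$ if $k\ge 0$ and $\binom{r}{k}=0$ if $k<0$. For integers $L,N,M\ge 0$ define $$Z(L;N,M)=\sum\binom{L}{N_r}\prod_{n\ge1}\binom{P'_n+M'_n}{M'_n}\binom{P_n+M_n}{M_n},\qquad \widetilde Z(L;N,M)=\sum\binom{L}{N_r}\prod_{n\ge1}\binom{P'_n+M'_n+n}{M'_n}\binom{P_n+M_n}{M_n},$$ where both sums run over all configurations of a non-negative integer $N_r$ and finitely supported families $(M_n)_{n\ge1}$, $(M'_n)_{n\ge1}$ of non-negative integers with $N=N_r+2\sum_{n\ge1}nM'_n$ and $M=\sum_{n\ge1}n(M_n+M'_n)$, and where $$P'_n=L-N+2\sum_{m>n}(m-n)M'_m,\qquad P_n=N-2M+2\sum_{m>n}(m-n)M_m .$$ Then, for all integers $L,N,M\ge0$ (in particular for $0\le 2M\le N\le L$, where all binomial coefficients in the definitions have non-negative entries), $$\text{i)}\quad Z(L;N,M)=\binom{L+2}{M}\binom{L}{N-M}-\binom{L}{M-1}\binom{L+2}{N-M+1},$$ $$\text{ii)}\quad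 \widetilde Z(L;N,M)=\binom{L}{M}\binom{L}{N-M}-\binom{L}{M-1}\binom{L}{N-M+1}.$$ -/

import Mathlib

namespace HubbardCount

/-- The binomial coefficient with an arbitrary integer upper entry `r`, that is
`r (r - 1) ⋯ (r - k + 1) / k!` for `k ≥ 0`, and `0` for `k < 0`. -/
def binom (r k : ℤ) : ℤ := if 0 ≤ k then Ring.choose r k.toNat else 0

/-- For a finitely supported family `(m_n)_{n ≥ 1}` of natural numbers: `∑_{n ≥ 1} n m_n`. -/
def weight (m : ℕ+ →₀ ℕ) : ℕ := m.sum fun n k => (n : ℕ) * k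

/-- For a finitely supported family `(m_j)_{j ≥ 1}` of natural numbers and `n ≥ 1`:
`∑_{j > n} (j - n) m_j`. -/
def tail (m : ℕ+ →₀ ℕ) (n : ℕ+) : ℤ :=
  m.sum fun j k => if n < j then ((j : ℤ) - (n : ℤ)) * (k : ℤ) else 0

/-- The string configurations `(N_r, (M'_n), (M_n))` with `N = N_r + 2 ∑ n M'_n` and
`M = ∑ n (M_n + M'_n)`. -/
def configSet (N M : ℕ) : Set (ℕ × (ℕ+ →₀ ℕ) × (ℕ+ →₀ ℕ)) :=
  {c | N = c.1 + 2 * weight c.2.1 ∧ M = weight (c.2.2 + c.2.1)}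

theorem weight_add (a b : ℕ+ →₀ ℕ) : weight (a + b) = weight a + weight b :=
  Finsupp.sum_add_index' (fun _ => Nat.mul_zero _) (fun _ _ _ => Nat.mul_add _ _ _)

theorem finite_weight_le (W : ℕ) : {m : ℕ+ →₀ ℕ | weight m ≤ W}.Finite := by
  refine (Set.finite_Iic (Finsupp.indicator (Finset.Icc (1 : ℕ+) W.succPNat)
    (fun _ _ => W))).subset ?_
  intro m hm n
  rcases Nat.eq_zero_or_pos (m n) with h0 | h0
  · rw [h0]; exact Nat.zero_le _
  have h1 : (n : ℕ) * m n ≤ W := le_trans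
    (Finset.single_le_sum (f := fun n : ℕ+ => (n : ℕ) * m n) (fun _ _ => Nat.zero_le _)
      (Finsupp.mem_support_iff.mpr h0.ne')) hm
  have hn : n ∈ Finset.Icc (1 : ℕ+) W.succPNat := by
    refine Finset.mem_Icc.mpr ⟨n.one_le, PNat.coe_le_coe _ _ |>.mp ?_⟩
    rw [Nat.succPNat_coe]
    nlinarith
  rw [Finsupp.indicator_of_mem hn]
  nlinarith [n.pos]

theorem configSet_finite (N M : ℕ) : (configSet N M).Finite := by
  refine ((Set.finite_Iic N).prod
    ((finite_weight_le M).prod (finite_weight_le M))).subset ?_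
  rintro ⟨r, a, b⟩ ⟨h1, h2⟩
  rw [weight_add] at h2
  simp only [Set.mem_prod, Set.mem_Iic, Set.mem_setOf_eq] at h1 h2 ⊢
  omega

/-- The finite set of all string configurations for given `N` and `M`. -/
noncomputable def configs (N M : ℕ) : Finset (ℕ × (ℕ+ →₀ ℕ) × (ℕ+ →₀ ℕ)) :=
  (configSet_finite N M).toFinset

/-- `P'_n = L - N + 2 ∑_{j > n} (j - n) M'_j`. -/
def P' (L N : ℕ) (m' : ℕ+ →₀ ℕ) (n : ℕ+) : ℤ := (L : ℤ) - N + 2 * tail m' n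

/-- `P_n = N - 2 M + 2 ∑_{j > n} (j - n) M_j`. -/
def P (N M : ℕ) (m : ℕ+ →₀ ℕ) (n : ℕ+) : ℤ := (N : ℤ) - 2 * M + 2 * tail m n

/-- `Z(L;N,M)`. The infinite products over `n ≥ 1` are taken over the supports of the families:
all other factors are `binom _ 0 = 1`. -/
noncomputable def Z (L N M : ℕ) : ℤ :=
  ∑ c ∈ configs N M,
    binom L c.1 *
      (c.2.1.prod fun n k => binom (P' L N c.2.1 n + k) k) *
      (c.2.2.prod fun n k => binom (P N M c.2.2 n + k) k)

/-- `Z̃(L;N,M)`: as `Z(L;N,M)`, with `P'_n + M'_n + n` in place of `P'_n + M'_n`. -/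
noncomputable def Ztilde (L N M : ℕ) : ℤ :=
  ∑ c ∈ configs N M,
    binom L c.1 *
      (c.2.1.prod fun n k => binom (P' L N c.2.1 n + k + (n : ℤ)) k) *
      (c.2.2.prod fun n k => binom (P N M c.2.2 n + k) k)

end HubbardCount

namespace HubbardCount

open Finset

theorem binom_of_neg (r : ℤ) {k : ℤ} (hk : k < 0) : binom r k = 0 := if_neg (not_le.mpr hk)

theorem binom_natCast_right (r : ℤ) (k : ℕ) : binom r k = Ring.choose r k := by
  simp [binom]

theorem binom_zero_right (r : ℤ) : binom r 0 = 1 := by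
  simp [binom]

theorem binom_natCast (n k : ℕ) : binom n k = n.choose k := by
  rw [binom_natCast_right, Ring.choose_natCast]

theorem binom_of_lt (n : ℕ) {k : ℤ} (hk : (n : ℤ) < k) : binom n k = 0 := by
  lift k to ℕ using by omega
  rw [binom_natCast, Nat.choose_eq_zero_of_lt (by omega), Nat.cast_zero]

theorem binom_symm (n : ℕ) (k : ℤ) : binom n (n - k) = binom n k := by
  rcases lt_or_ge k 0 with hk | hk
  · rw [binom_of_neg _ hk, binom_of_lt _ (by omega)]
  rcases lt_or_ge (n : ℤ) k with hn | hn
  · rw [binom_of_neg _ (by omega : (n : ℤ) - k < 0), binom_of_lt _ hn]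
  lift k to ℕ using hk
  have hkn : k ≤ n := by omega
  rw [← Nat.cast_sub hkn, binom_natCast, binom_natCast, Nat.choose_symm hkn]

/-- Pascal's rule. -/
theorem binom_pascal (r k : ℤ) : binom (r + 1) k = binom r k + binom r (k - 1) := by
  rcases lt_trichotomy k 0 with hk | rfl | hk
  · rw [binom_of_neg _ hk, binom_of_neg _ hk, binom_of_neg _ (by omega), add_zero]
  · rw [binom_zero_right, binom_zero_right, binom_of_neg _ (by omega), add_zero]
  · obtain ⟨j, rfl⟩ : ∃ j : ℕ, k = (j + 1 : ℕ) := ⟨(k - 1).toNat, by omega⟩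
    rw [show ((j + 1 : ℕ) : ℤ) - 1 = (j : ℕ) by push_cast; ring, binom_natCast_right,
      binom_natCast_right, binom_natCast_right, Ring.choose_succ_succ, add_comm]

/-- The trinomial revision. -/
theorem binom_mul_binom (r : ℤ) (n : ℕ) (k : ℤ) :
    binom r n * binom n k = binom r k * binom (r - k) (n - k) := by
  rcases lt_or_ge k 0 with hk | hk
  · rw [binom_of_neg _ hk, binom_of_neg _ hk, mul_zero, zero_mul]
  rcases lt_or_ge (n : ℤ) k with hn | hn
  · rw [binom_of_neg _ (by omega : (n : ℤ) - k < 0), binom_of_lt _ hn, mul_zero, mul_zero]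
  lift k to ℕ using hk
  have hkn : k ≤ n := by omega
  have h := Ring.choose_smul_choose r hkn
  rw [← Nat.cast_sub hkn, binom_natCast, binom_natCast_right, binom_natCast_right,
    binom_natCast_right, ← h, nsmul_eq_mul, mul_comm]

theorem binom_mul_binom_comm (r i j : ℤ) :
    binom r i * binom (r - i) j = binom r j * binom (r - j) i := by
  rcases lt_or_ge i 0 with hi | hi
  · rw [binom_of_neg _ hi, binom_of_neg _ hi, mul_zero, zero_mul]
  rcases lt_or_ge j 0 with hj | hj
  · rw [binom_of_neg _ hj, binom_of_neg _ hj, mul_zero, zero_mul]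
  lift i to ℕ using hi
  lift j to ℕ using hj
  have h1 := binom_mul_binom r (i + j) i
  have h2 := binom_mul_binom r (i + j) j
  have h3 := binom_symm (i + j) i
  push_cast at h1 h2 h3
  rw [add_sub_cancel_left] at h1 h3
  rw [add_sub_cancel_right] at h2
  rw [← h1, ← h2, h3]

/-- Vandermonde's convolution. -/
theorem sum_binom_mul_binom (r s : ℤ) (n K : ℕ) (hK : n < K) :
    ∑ j ∈ range K, binom r (n - j) * binom s j = binom (r + s) n := by
  obtain ⟨d, rfl⟩ : ∃ d, K = n + 1 + d := ⟨K - (n + 1), by omega⟩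
  rw [sum_range_add, sum_eq_zero (s := range d), add_zero, binom_natCast_right,
    Ring.add_choose_eq n (Commute.all r s), ← Finset.Nat.sum_antidiagonal_swap,
    Nat.sum_antidiagonal_eq_sum_range_succ_mk]
  · refine sum_congr rfl fun j hj => ?_
    have hjn : j ≤ n := by simpa [Nat.lt_succ_iff] using hj
    rw [← Nat.cast_sub hjn, binom_natCast_right, binom_natCast_right]
    rfl
  · intro j _
    rw [binom_of_neg _ (by push_cast; omega), zero_mul]

/-- A form of the Pfaff–Saalschütz summation. -/
theorem sum_binom_mul_binom_mul_binom (K s : ℕ) : ∀ (l : ℕ), l < K → ∀ t z : ℤ,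
    ∑ j ∈ range K, binom s (t - j) * binom z j * binom (z + s + l - j) (l - j) =
      binom (l + s) t * binom (z + l + s - t) l := by
  induction s with
  | zero =>
    intro l hl t z
    have hoff : ∀ j : ℕ, (j : ℤ) ≠ t → binom ((0 : ℕ) : ℤ) (t - j) = 0 := by
      intro j hj
      rcases lt_or_gt_of_ne hj with h | h
      · exact binom_of_lt 0 (by push_cast; omega)
      · exact binom_of_neg _ (by omega)
    by_cases ht : 0 ≤ t ∧ t < K
    · obtain ⟨ht0, htK⟩ := ht
      lift t to ℕ using ht0
      rw [sum_eq_single t]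
      · rw [sub_self, binom_zero_right, one_mul, Nat.cast_zero, add_zero, add_zero, add_zero]
        have h1 := binom_mul_binom (z + l - t) l (l - t)
        rw [binom_symm, show z + (l : ℤ) - t - (l - t) = z by ring,
          show (l : ℤ) - (l - t) = t by ring] at h1
        linarith
      · intro j _ hj
        rw [hoff j (by exact_mod_cast hj), zero_mul, zero_mul]
      · intro h
        exact absurd (mem_range.mpr (by omega)) h
    · rw [sum_eq_zero, Nat.cast_zero, add_zero]
      · rcases not_and_or.mp ht with h | h
        · rw [binom_of_neg _ (by omega), zero_mul]
        · rw [binom_of_lt l (by omega), zero_mul]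
      · intro j hj
        rw [mem_range] at hj
        rw [hoff j (by omega), zero_mul, zero_mul]
  | succ s ihs =>
    intro l
    induction l with
    | zero =>
      intro hl t z
      rw [sum_eq_single 0]
      · simp [binom_zero_right]
      · intro j _ hj
        rw [binom_of_neg _ (by push_cast; omega : ((0 : ℕ) : ℤ) - j < 0), mul_zero]
      · intro h
        exact absurd (mem_range.mpr hl) h
    | succ l ihl =>
      intro hl t z
      have e1 := ihs (l + 1) hl t z
      have e2 := ihs (l + 1) hl (t - 1) z
      have e3 := ihl (by omega) t z
      have key : ∀ j : ℕ, binom ((s + 1 : ℕ) : ℤ) (t - j) * binom z j *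
            binom (z + (s + 1 : ℕ) + (l + 1 : ℕ) - j) ((l + 1 : ℕ) - j) =
          binom s (t - j) * binom z j * binom (z + s + (l + 1 : ℕ) - j) ((l + 1 : ℕ) - j) +
          binom s (t - 1 - j) * binom z j * binom (z + s + (l + 1 : ℕ) - j) ((l + 1 : ℕ) - j) +
          binom ((s + 1 : ℕ) : ℤ) (t - j) * binom z j *
            binom (z + (s + 1 : ℕ) + l - j) (l - j) := by
        intro j
        have p1 := binom_pascal s (t - j)
        have p2 := binom_pascal (z + s + (l + 1 : ℕ) - j) ((l + 1 : ℕ) - j)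
        rw [show z + s + ((l + 1 : ℕ) : ℤ) - j + 1 = z + (s + 1 : ℕ) + (l + 1 : ℕ) - j by
          push_cast; ring, show ((l + 1 : ℕ) : ℤ) - j - 1 = l - j by push_cast; ring] at p2
        rw [p2, show z + ((s + 1 : ℕ) : ℤ) + l - j = z + s + (l + 1 : ℕ) - j by push_cast; ring,
          Nat.cast_succ s, p1, show t - (j : ℤ) - 1 = t - 1 - j by ring]
        ring
      rw [sum_congr rfl fun j _ => key j, sum_add_distrib, sum_add_distrib, e1, e2, e3]
      have q1 := binom_pascal (l + 1 + s) t
      have q2 := binom_pascal (z + l + 1 + s - t) (l + 1)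
      push_cast
      rw [show (l : ℤ) + 1 + (s + 1) = l + 1 + s + 1 by ring, q1,
        show z + ((l : ℤ) + 1) + (s + 1) - t = z + l + 1 + s - t + 1 by ring, q2,
        show z + ((l : ℤ) + 1) + s - (t - 1) = z + l + 1 + s - t + 1 by ring, q2,
        show (l : ℤ) + (s + 1) = l + 1 + s by ring,
        show z + (l : ℤ) + (s + 1) - t = z + l + 1 + s - t by ring,
        show z + ((l : ℤ) + 1) + s - t = z + l + 1 + s - t by ring,
        show (l : ℤ) + 1 - 1 = l by ring]
      ring

/-- The number of ways to choose two sets of sizes `p` and `q` with `a` common elements from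
a set of size `r`, counted in two ways. -/
theorem binom_mul_binom_mul_binom (r p q a : ℤ) :
    binom r (p + q - 2 * a) * binom (p + q - 2 * a) (p - a) * binom (r - p - q + 2 * a) a =
      binom r p * (binom p a * binom (r - p) (q - a)) := by
  rcases lt_or_ge p 0 with hp | hp
  · rw [binom_of_neg r hp, zero_mul]
    rcases lt_or_ge a 0 with ha | ha
    · rw [binom_of_neg _ ha, mul_zero]
    · rw [binom_of_neg _ (by omega : p - a < 0), mul_zero, zero_mul]
  lift p to ℕ using hp
  rw [← mul_assoc, binom_mul_binom]
  rcases lt_or_ge ((p : ℤ) + q - 2 * a) 0 with hr | hr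
  · rw [binom_of_neg _ hr, zero_mul, zero_mul]
    rcases lt_or_ge (p : ℤ) a with ha | ha
    · rw [binom_of_neg _ (by omega : (p : ℤ) - a < 0), mul_zero, zero_mul]
    · rw [binom_of_neg _ (by omega : q - a < 0), mul_zero]
  obtain ⟨n, hn⟩ : ∃ n : ℕ, (n : ℤ) = p + q - 2 * a := ⟨_, Int.toNat_of_nonneg hr⟩
  rw [← hn, binom_mul_binom, hn]
  have h1 := binom_mul_binom_comm r a (p - a)
  have h2 := binom_mul_binom_comm (r - (p - a)) (q - a) a
  rw [show r - ((p : ℤ) - a) - (q - a) = r - p - q + 2 * a by ring,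
    show r - ((p : ℤ) - a) - a = r - p by ring] at h2
  rw [show (p : ℤ) + q - 2 * a - (p - a) = q - a by ring, mul_assoc, h2, h1, mul_assoc]

theorem sum_binom_mul_binom_mul_binom_of_lt (r p q : ℤ) (K : ℕ) (hK : p < K) :
    ∑ a ∈ range K, binom r (p + q - 2 * a) * binom (p + q - 2 * a) (p - a) *
        binom (r - p - q + 2 * a) a =
      binom r p * binom r q := by
  rw [sum_congr rfl fun (a : ℕ) _ => binom_mul_binom_mul_binom r p q a, ← mul_sum]
  rcases lt_or_ge p 0 with hp | hp
  · rw [binom_of_neg r hp, zero_mul, zero_mul]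
  lift p to ℕ using hp
  congr 1
  rcases lt_or_ge q 0 with hq | hq
  · rw [binom_of_neg _ hq]
    exact sum_eq_zero fun a _ => by rw [binom_of_neg _ (by omega : q - a < 0), mul_zero]
  lift q to ℕ using hq
  have h := sum_binom_mul_binom (r - p) p q (K + q + 1) (by omega)
  rw [show K + q + 1 = K + (q + 1) by ring, sum_range_add, sum_eq_zero (s := range (q + 1)),
    add_zero, sub_add_cancel] at h
  · rw [← h]
    exact sum_congr rfl fun a _ => mul_comm _ _
  · intro a _
    rw [binom_of_lt p (by push_cast; omega), mul_zero]

/-- The total number `∑_{n ≥ 1} m_n` of a family. -/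
def size (m : ℕ+ →₀ ℕ) : ℕ := m.sum fun _ k => k

/-- The shift `n ↦ n + 1` of the positive integers. -/
def succEmb : ℕ+ ↪ ℕ+ := ⟨fun n => n + 1, fun _ _ h => add_right_cancel h⟩

/-- The family `(k, m_1, m_2, …)`. -/
noncomputable def cons (k : ℕ) (m : ℕ+ →₀ ℕ) : ℕ+ →₀ ℕ :=
  Finsupp.single 1 k + m.embDomain succEmb

/-- The family `(m_2, m_3, …)`. -/
noncomputable def behead (m : ℕ+ →₀ ℕ) : ℕ+ →₀ ℕ :=
  m.comapDomain succEmb succEmb.injective.injOn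

theorem one_notMem_range_succEmb : (1 : ℕ+) ∉ Set.range succEmb := by
  rintro ⟨n, hn⟩
  exact (PNat.lt_add_left 1 n).ne hn.symm

theorem cons_apply_one (k : ℕ) (m : ℕ+ →₀ ℕ) : cons k m 1 = k := by
  rw [cons, Finsupp.add_apply, Finsupp.single_eq_same,
    Finsupp.embDomain_of_notMem_range _ _ _ one_notMem_range_succEmb, add_zero]

theorem cons_apply_succ (k : ℕ) (m : ℕ+ →₀ ℕ) (n : ℕ+) : cons k m (n + 1) = m n := by
  rw [cons, Finsupp.add_apply, Finsupp.single_eq_of_ne (PNat.lt_add_left 1 n).ne', zero_add]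
  exact Finsupp.embDomain_apply_self succEmb m n

theorem behead_cons (k : ℕ) (m : ℕ+ →₀ ℕ) : behead (cons k m) = m := by
  ext n
  exact cons_apply_succ k m n

theorem cons_behead (m : ℕ+ →₀ ℕ) : cons (m 1) (behead m) = m := by
  ext n
  induction n using PNat.recOn with
  | one => exact cons_apply_one _ _
  | succ n _ => rw [cons_apply_succ]; rfl

@[to_additive]
theorem prod_cons {A : Type*} [CommMonoid A] (f : ℕ+ → ℕ → A) (hf : ∀ n, f n 0 = 1) (k : ℕ)
    (m : ℕ+ →₀ ℕ) : (cons k m).prod f = f 1 k * m.prod fun n => f (n + 1) := by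
  rw [cons, Finsupp.prod_add_index_of_disjoint, Finsupp.prod_single_index (hf 1),
    Finsupp.prod_embDomain]
  · rfl
  · rw [Finsupp.support_embDomain]
    refine disjoint_left.mpr fun n hn hm => ?_
    obtain rfl := mem_singleton.mp (Finsupp.support_single_subset hn)
    obtain ⟨j, _, hj⟩ := mem_map.mp hm
    exact one_notMem_range_succEmb ⟨j, hj⟩

theorem size_cons (k : ℕ) (m : ℕ+ →₀ ℕ) : size (cons k m) = k + size m :=
  sum_cons _ (fun _ => rfl) k m

theorem weight_cons (k : ℕ) (m : ℕ+ →₀ ℕ) :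
    weight (cons k m) = k + size m + weight m := by
  rw [weight, sum_cons _ (fun _ => Nat.mul_zero _), PNat.one_coe, one_mul, add_assoc, size, weight,
    ← Finsupp.sum_add]
  congr 1
  refine Finsupp.sum_congr fun n _ => ?_
  rw [PNat.add_coe, PNat.one_coe]
  ring

theorem tail_cons_one (k : ℕ) (m : ℕ+ →₀ ℕ) : tail (cons k m) 1 = weight m := by
  rw [tail, sum_cons _ (fun _ => by simp), if_neg (lt_irrefl _), zero_add, weight, Finsupp.sum,
    Finsupp.sum, Nat.cast_sum]
  refine sum_congr rfl fun n _ => ?_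
  rw [if_pos (PNat.lt_add_left 1 n)]
  push_cast
  ring

theorem tail_cons_succ (k : ℕ) (m : ℕ+ →₀ ℕ) (n : ℕ+) : tail (cons k m) (n + 1) = tail m n := by
  rw [tail, sum_cons _ (fun _ => by simp), if_neg (not_lt.mpr one_le), zero_add, tail]
  refine Finsupp.sum_congr fun j _ => ?_
  simp only [add_lt_add_iff_right, PNat.add_coe, PNat.one_coe]
  push_cast
  simp only [add_sub_add_right_eq_sub]

/-- The product `∏_{n ≥ 1} binom (x + y n + 2 ∑_{j > n} (j - n) m_j + m_n) m_n`. -/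
noncomputable def stringProd (x y : ℤ) (m : ℕ+ →₀ ℕ) : ℤ :=
  m.prod fun n k => binom (x + y * (n : ℤ) + 2 * tail m n + k) k

theorem stringProd_cons (x y : ℤ) (k : ℕ) (m : ℕ+ →₀ ℕ) :
    stringProd x y (cons k m) =
      binom (x + y + 2 * weight m + k) k * stringProd (x + y) y m := by
  rw [stringProd, prod_cons _ (fun _ => binom_zero_right _), tail_cons_one, PNat.one_coe,
    Nat.cast_one, mul_one, stringProd]
  congr 1
  refine Finsupp.prod_congr fun n _ => ?_
  rw [tail_cons_succ, PNat.add_coe, PNat.one_coe]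
  congr 1
  push_cast
  ring

/-- The families of given weight. -/
noncomputable def ofWeight (a : ℕ) : Finset (ℕ+ →₀ ℕ) :=
  ((finite_weight_le a).subset fun _ h => le_of_eq h : {m | weight m = a}.Finite).toFinset

theorem mem_ofWeight {a : ℕ} {m : ℕ+ →₀ ℕ} : m ∈ ofWeight a ↔ weight m = a := by
  simp [ofWeight]

/-- The families of given weight and size. -/
noncomputable def ofWeightSize (a l : ℕ) : Finset (ℕ+ →₀ ℕ) := {m ∈ ofWeight a | size m = l}

theorem mem_ofWeightSize {a l : ℕ} {m : ℕ+ →₀ ℕ} :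
    m ∈ ofWeightSize a l ↔ weight m = a ∧ size m = l := by
  rw [ofWeightSize, mem_filter, mem_ofWeight]

theorem size_le_weight (m : ℕ+ →₀ ℕ) : size m ≤ weight m := by
  rw [← cons_behead m, size_cons, weight_cons]
  exact Nat.le_add_right _ _

theorem eq_zero_of_size_eq_zero {m : ℕ+ →₀ ℕ} (h : size m = 0) : m = 0 := by
  ext n
  by_contra hn
  exact hn (sum_eq_zero_iff.mp h n (Finsupp.mem_support_iff.mpr hn))

theorem weight_zero : weight 0 = 0 := Finsupp.sum_zero_index

theorem sum_ofWeightSize (a l : ℕ) (f : (ℕ+ →₀ ℕ) → ℤ) :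
    ∑ m ∈ ofWeightSize (l + a) l, f m =
      ∑ j ∈ range (l + 1), ∑ m ∈ ofWeightSize a j, f (cons (l - j) m) := by
  rw [sum_sigma']
  refine sum_bij' (fun m _ => ⟨size (behead m), behead m⟩) (fun s _ => cons (l - s.1) s.2)
    ?_ ?_ ?_ ?_ ?_
  · intro m hm
    rw [mem_ofWeightSize, ← cons_behead m, size_cons, weight_cons] at hm
    rw [mem_sigma, mem_range, mem_ofWeightSize]
    dsimp only
    omega
  · intro s hs
    rw [mem_sigma, mem_range, mem_ofWeightSize] at hs
    rw [mem_ofWeightSize, size_cons, weight_cons]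
    omega
  · intro m hm
    rw [mem_ofWeightSize, ← cons_behead m, size_cons, weight_cons] at hm
    dsimp only
    rw [show l - size (behead m) = m 1 by omega, cons_behead]
  · rintro ⟨j, m⟩ hs
    rw [mem_sigma, mem_range, mem_ofWeightSize] at hs
    dsimp only at hs ⊢
    rw [behead_cons, hs.2.2]
  · intro m hm
    rw [mem_ofWeightSize, ← cons_behead m, size_cons, weight_cons] at hm
    dsimp only
    rw [show l - size (behead m) = m 1 by omega, cons_behead]

theorem sum_stringProd_cons (x y : ℤ) (a l : ℕ) :
    ∑ m ∈ ofWeightSize (l + a) l, stringProd x y m =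
      ∑ j ∈ range (l + 1), (∑ m ∈ ofWeightSize a j, stringProd (x + y) y m) *
        binom (x + y + 2 * a + l - j) (l - j) := by
  rw [sum_ofWeightSize]
  refine sum_congr rfl fun j hj => ?_
  rw [mem_range] at hj
  rw [sum_mul]
  refine sum_congr rfl fun m hm => ?_
  rw [stringProd_cons, (mem_ofWeightSize.mp hm).1, Nat.cast_sub (by omega), mul_comm,
    ← add_sub_assoc]

/-- A function with the recursion of the refined string sums is equal to them. -/
theorem sum_stringProd_eq (y : ℤ) (G : ℤ → ℕ → ℕ → ℤ) (h00 : ∀ x, G x 0 0 = 1)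
    (h0 : ∀ x a, a ≠ 0 → G x a 0 = 0) (hlt : ∀ x a l, a < l → G x a l = 0)
    (hrec : ∀ x a l, l ≠ 0 → G x (l + a) l =
      ∑ j ∈ range (l + 1), G (x + y) a j * binom (x + y + 2 * a + l - j) (l - j))
    (x : ℤ) (a l : ℕ) : ∑ m ∈ ofWeightSize a l, stringProd x y m = G x a l := by
  induction a using Nat.strong_induction_on generalizing x l with
  | _ a ih =>
    rcases lt_or_ge a l with hal | hal
    · rw [hlt x a l hal, sum_eq_zero]
      intro m hm
      have := size_le_weight m
      rw [mem_ofWeightSize] at hm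
      omega
    obtain ⟨b, rfl⟩ := Nat.exists_eq_add_of_le hal
    rcases Nat.eq_zero_or_pos l with rfl | hl
    · rcases Nat.eq_zero_or_pos b with rfl | hb
      · have : ofWeightSize (0 + 0) 0 = {0} := by
          ext m
          rw [mem_ofWeightSize, mem_singleton]
          exact ⟨fun h => eq_zero_of_size_eq_zero h.2, by rintro rfl; exact ⟨rfl, rfl⟩⟩
        rw [this, sum_singleton, h00]
        rfl
      · rw [h0 x _ (by omega), sum_eq_zero]
        intro m hm
        rw [mem_ofWeightSize] at hm
        rw [eq_zero_of_size_eq_zero hm.2, weight_zero] at hm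
        omega
    · rw [sum_stringProd_cons, hrec x b l hl.ne']
      exact sum_congr rfl fun j _ => by rw [ih b (by omega)]

theorem sum_ofWeight_eq_sum_size (a : ℕ) (f : (ℕ+ →₀ ℕ) → ℤ) :
    ∑ m ∈ ofWeight a, f m = ∑ l ∈ range (a + 1), ∑ m ∈ ofWeightSize a l, f m := by
  refine (sum_fiberwise_of_maps_to (g := size) (fun m hm => ?_) f).symm
  rw [mem_range, Nat.lt_succ_iff, ← mem_ofWeight.mp hm]
  exact size_le_weight m

theorem sum_stringProd_one_size (x : ℤ) (a l : ℕ) :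
    ∑ m ∈ ofWeightSize a l, stringProd x 1 m =
      binom (a - 1) (a - l) * binom (x + a + 1) l := by
  refine sum_stringProd_eq 1
    (fun x a l => binom (a - 1) (a - l) * binom (x + a + 1) l) ?_ ?_ ?_ ?_ x a l
  · intro x
    simp [binom_zero_right]
  · intro x a ha
    rw [← Nat.cast_pred (Nat.pos_of_ne_zero ha), binom_of_lt _ (by omega), zero_mul]
  · intro x a l h
    rw [binom_of_neg _ (by omega), zero_mul]
  · intro x a l hl
    rcases Nat.eq_zero_or_pos a with rfl | ha
    · rw [sum_eq_single 0]
      · simp only [Nat.cast_zero, add_zero, sub_self, sub_zero, binom_zero_right, mul_zero]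
        rw [show x + (l : ℤ) + 1 = x + 1 + l by ring, one_mul, one_mul, one_mul]
      · intro j _ hj
        rw [binom_of_neg _ (by omega : ((0 : ℕ) : ℤ) - j < 0), zero_mul, zero_mul]
      · intro h
        exact absurd (mem_range.mpr (by omega)) h
    · obtain ⟨s, rfl⟩ : ∃ s, a = s + 1 := ⟨a - 1, by omega⟩
      have h := sum_binom_mul_binom_mul_binom (l + 1) s l (by omega) (s + 1 : ℕ)
        (x + 1 + (s + 1 : ℕ) + 1)
      push_cast at h ⊢
      rw [show (l : ℤ) + (s + 1) - 1 = l + s by ring, show (l : ℤ) + (s + 1) - l = s + 1 by ring,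
        show x + ((l : ℤ) + (s + 1)) + 1 = x + 1 + (s + 1) + 1 + l + s - (s + 1) by ring, ← h]
      refine sum_congr rfl fun j _ => ?_
      rw [add_sub_cancel_right,
        show x + 1 + ((s : ℤ) + 1) + 1 + s + l - j = x + 1 + 2 * (s + 1) + l - j by ring]

theorem sum_stringProd_zero_size (x : ℤ) (a l : ℕ) :
    ∑ m ∈ ofWeightSize a l, stringProd x 0 m =
      binom (a - 1) (a - l) * binom (x + a + 1) l - binom a (a - l) * binom (x + a) (l - 1) := by
  refine sum_stringProd_eq 0 (fun x a l => binom (a - 1) (a - l) * binom (x + a + 1) l -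
    binom a (a - l) * binom (x + a) (l - 1)) ?_ ?_ ?_ ?_ x a l
  · intro x
    simp [binom_zero_right, binom_of_neg]
  · intro x a ha
    rw [← Nat.cast_pred (Nat.pos_of_ne_zero ha), binom_of_lt (a - 1) (by omega), zero_mul,
      binom_of_neg _ (by omega : ((0 : ℕ) : ℤ) - 1 < 0), mul_zero, sub_zero]
  · intro x a l h
    rw [binom_of_neg _ (by omega : (a : ℤ) - l < 0), binom_of_neg _ (by omega : (a : ℤ) - l < 0),
      zero_mul, zero_mul, sub_zero]
  · intro x a l hl
    obtain ⟨k, rfl⟩ : ∃ k, l = k + 1 := ⟨l - 1, by omega⟩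
    rcases Nat.eq_zero_or_pos a with rfl | ha
    · rw [sum_eq_single 0]
      · have p := binom_pascal (x + k + 1) (k + 1)
        simp only [Nat.cast_zero, add_zero, sub_self, sub_zero, binom_zero_right, mul_zero,
          one_mul]
        push_cast
        rw [binom_of_neg _ (by omega : (-1 : ℤ) < 0), sub_zero, one_mul, ← add_assoc, p]
        ring
      · intro j _ hj
        rw [binom_of_neg _ (by omega : ((0 : ℕ) : ℤ) - j < 0),
          binom_of_neg _ (by omega : ((0 : ℕ) : ℤ) - j < 0), zero_mul, zero_mul, sub_zero, zero_mul]
      · intro h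
        exact absurd (mem_range.mpr (by omega)) h
    · obtain ⟨s, rfl⟩ : ∃ s, a = s + 1 := ⟨a - 1, by omega⟩
      have h1 := sum_binom_mul_binom_mul_binom (k + 1 + 1) s (k + 1) (by omega) (s + 1 : ℕ)
        (x + (s + 1 : ℕ) + 1)
      have h2 := sum_binom_mul_binom_mul_binom (k + 1) (s + 1) k (by omega) s (x + (s + 1 : ℕ))
      have h3 : ∑ j ∈ range (k + 1 + 1), binom ((s + 1 : ℕ) : ℤ) ((s + 1 : ℕ) - j) *
          binom (x + (s + 1 : ℕ)) (j - 1) *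
            binom (x + (s + 1 : ℕ) + (s + 1 : ℕ) + (k + 1 : ℕ) - j) ((k + 1 : ℕ) - j) =
          ∑ j ∈ range (k + 1), binom ((s + 1 : ℕ) : ℤ) (s - j) *
          binom (x + (s + 1 : ℕ)) j *
            binom (x + (s + 1 : ℕ) + (s + 1 : ℕ) + k - j) (k - j) := by
        rw [sum_range_succ', binom_of_neg _ (by omega : ((0 : ℕ) : ℤ) - 1 < 0), mul_zero, zero_mul,
          add_zero]
        refine sum_congr rfl fun j _ => ?_
        push_cast
        rw [add_sub_cancel_right, add_sub_add_right_eq_sub, add_sub_add_right_eq_sub,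
          show x + ((s : ℤ) + 1) + (s + 1) + (k + 1) - (j + 1) = x + (s + 1) + (s + 1) + k - j by
            ring]
      rw [← h3] at h2
      have p1 := binom_pascal (k + 1 + s) (s + 1)
      have p2 := binom_pascal (x + k + 1 + s + 1) (k + 1)
      have h : ∑ j ∈ range (k + 1 + 1),
          (binom (((s + 1 : ℕ) : ℤ) - 1) ((s + 1 : ℕ) - j) * binom (x + 0 + (s + 1 : ℕ) + 1) j -
            binom ((s + 1 : ℕ) : ℤ) ((s + 1 : ℕ) - j) * binom (x + 0 + (s + 1 : ℕ)) (j - 1)) *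
          binom (x + 0 + 2 * (s + 1 : ℕ) + (k + 1 : ℕ) - j) ((k + 1 : ℕ) - j) =
          binom ((k + 1 : ℕ) + s) (s + 1 : ℕ) *
            binom (x + (s + 1 : ℕ) + 1 + (k + 1 : ℕ) + s - (s + 1 : ℕ)) (k + 1 : ℕ) -
          binom (k + (s + 1 : ℕ)) s * binom (x + (s + 1 : ℕ) + k + (s + 1 : ℕ) - s) k := by
        rw [← h1, ← h2, ← sum_sub_distrib]
        refine sum_congr rfl fun j _ => ?_
        rw [Nat.cast_succ s, add_sub_cancel_right, add_zero, sub_mul,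
          show x + ((s : ℤ) + 1) + 1 + s + (k + 1 : ℕ) - j = x + 2 * (s + 1) + (k + 1 : ℕ) - j by
            ring,
          show x + ((s : ℤ) + 1) + (s + 1) + (k + 1 : ℕ) - j = x + 2 * (s + 1) + (k + 1 : ℕ) - j by
            ring]
      rw [h]
      push_cast
      rw [show (k : ℤ) + 1 + (s + 1) - 1 = k + 1 + s by ring,
        show (k : ℤ) + 1 + (s + 1) - (k + 1) = s + 1 by ring,
        show x + ((k : ℤ) + 1 + (s + 1)) + 1 = x + k + 1 + s + 1 + 1 by ring,
        show (k : ℤ) + 1 + (s + 1) = k + 1 + s + 1 by ring,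
        show x + ((k : ℤ) + 1 + s + 1) = x + k + 1 + s + 1 by ring,
        show x + ((s : ℤ) + 1) + 1 + (k + 1) + s - (s + 1) = x + k + 1 + s + 1 by ring,
        show (k : ℤ) + (s + 1) = k + 1 + s by ring,
        show x + ((s : ℤ) + 1) + k + (s + 1) - s = x + k + 1 + s + 1 by ring,
        p1, p2]
      ring_nf

theorem sum_stringProd_one (x : ℤ) (a : ℕ) :
    ∑ m ∈ ofWeight a, stringProd x 1 m = binom (x + 2 * a) a := by
  rw [sum_ofWeight_eq_sum_size, sum_congr rfl fun l _ => sum_stringProd_one_size x a l,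
    sum_binom_mul_binom _ _ a (a + 1) a.lt_succ_self]
  congr 1
  ring

theorem sum_stringProd_zero (x : ℤ) (a : ℕ) :
    ∑ m ∈ ofWeight a, stringProd x 0 m =
      binom (x + 2 * a) a - binom (x + 2 * a) (a - 1) := by
  rw [sum_ofWeight_eq_sum_size, sum_congr rfl fun l _ => sum_stringProd_zero_size x a l,
    sum_sub_distrib, sum_binom_mul_binom _ _ a (a + 1) a.lt_succ_self,
    show (a : ℤ) - 1 + (x + a + 1) = x + 2 * a by ring]
  congr 1
  rw [sum_range_succ', binom_of_neg _ (by omega : ((0 : ℕ) : ℤ) - 1 < 0), mul_zero, add_zero]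
  rcases Nat.eq_zero_or_pos a with rfl | ha
  · rw [binom_of_neg _ (by omega : ((0 : ℕ) : ℤ) - 1 < 0), sum_range_zero]
  · obtain ⟨b, rfl⟩ : ∃ b, a = b + 1 := ⟨a - 1, by omega⟩
    have h := sum_binom_mul_binom (b + 1 : ℕ) (x + (b + 1 : ℕ)) b (b + 1) b.lt_succ_self
    rw [show ((b + 1 : ℕ) : ℤ) + (x + (b + 1 : ℕ)) = x + 2 * (b + 1 : ℕ) by ring] at h
    rw [Nat.cast_succ b, add_sub_cancel_right, ← Nat.cast_succ, ← h]
    refine sum_congr rfl fun j _ => ?_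
    push_cast
    rw [add_sub_add_right_eq_sub, add_sub_cancel_right]

theorem mem_configs {N M : ℕ} {c : ℕ × (ℕ+ →₀ ℕ) × (ℕ+ →₀ ℕ)} :
    c ∈ configs N M ↔ N = c.1 + 2 * weight c.2.1 ∧ M = weight c.2.2 + weight c.2.1 := by
  rw [configs, Set.Finite.mem_toFinset, ← weight_add]
  rfl

/-- A sum over configurations factors for every value of the weight of the first family. -/
theorem sum_configs (L N M : ℕ) (f g : (ℕ+ →₀ ℕ) → ℤ) :
    ∑ c ∈ configs N M, binom L c.1 * f c.2.1 * g c.2.2 =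
      ∑ a ∈ range (M + 1), binom L (N - 2 * a) * (∑ m ∈ ofWeight a, f m) *
        ∑ m ∈ ofWeight (M - a), g m := by
  rw [← sum_fiberwise_of_maps_to (s := configs N M) (t := range (M + 1))
    (g := fun c => weight c.2.1)]
  · refine sum_congr rfl fun a ha => ?_
    rw [mem_range] at ha
    rcases lt_or_ge N (2 * a) with h | h
    · rw [binom_of_neg _ (by omega), zero_mul, zero_mul, sum_eq_zero]
      intro c hc
      rw [mem_filter, mem_configs] at hc
      omega
    · rw [mul_assoc, sum_mul_sum, ← sum_product', mul_sum]
      refine sum_bij' (fun c _ => c.2) (fun d _ => (N - 2 * a, d)) ?_ ?_ ?_ ?_ ?_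
      · intro c hc
        rw [mem_filter, mem_configs] at hc
        rw [mem_product, mem_ofWeight, mem_ofWeight]
        omega
      · intro d hd
        rw [mem_product, mem_ofWeight, mem_ofWeight] at hd
        rw [mem_filter, mem_configs]
        dsimp only
        omega
      · rintro ⟨r, c⟩ hc
        rw [mem_filter, mem_configs] at hc
        dsimp only at hc ⊢
        rw [show N - 2 * a = r by omega]
      · intro d _
        rfl
      · intro c hc
        rw [mem_filter, mem_configs] at hc
        rw [mul_assoc, show (N : ℤ) - 2 * a = c.1 by omega]
  · intro c hc
    rw [mem_configs] at hc
    rw [mem_range]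
    omega

theorem sum_stringProd_zero_sub (N M a : ℕ) (ha : a ≤ M) :
    ∑ m ∈ ofWeight (M - a), stringProd (N - 2 * M) 0 m =
      binom (N - 2 * a) (M - a) - binom (N - 2 * a) (M - a - 1) := by
  rw [sum_stringProd_zero, Nat.cast_sub ha,
    show (N : ℤ) - 2 * M + 2 * (M - a) = N - 2 * a by ring]

theorem prod_eq_stringProd_zero (N M : ℕ) (m : ℕ+ →₀ ℕ) :
    (m.prod fun n k => binom (P N M m n + k) k) = stringProd (N - 2 * M) 0 m := by
  refine Finsupp.prod_congr fun n _ => ?_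
  rw [P, zero_mul, add_zero]

theorem prod_eq_stringProd_zero' (L N : ℕ) (m : ℕ+ →₀ ℕ) :
    (m.prod fun n k => binom (P' L N m n + k) k) = stringProd (L - N) 0 m := by
  refine Finsupp.prod_congr fun n _ => ?_
  rw [P', zero_mul, add_zero]

theorem prod_eq_stringProd_one (L N : ℕ) (m : ℕ+ →₀ ℕ) :
    (m.prod fun n k => binom (P' L N m n + k + (n : ℤ)) k) = stringProd (L - N) 1 m := by
  refine Finsupp.prod_congr fun n _ => ?_
  rw [P', one_mul]
  congr 1
  ring

theorem Z_eq_sum (L N M : ℕ) :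
    Z L N M = ∑ a ∈ range (M + 1), binom L (N - 2 * a) *
      (binom (L - N + 2 * a) a - binom (L - N + 2 * a) (a - 1)) *
        (binom (N - 2 * a) (M - a) - binom (N - 2 * a) (M - a - 1)) := by
  simp only [Z, prod_eq_stringProd_zero, prod_eq_stringProd_zero']
  rw [sum_configs]
  refine sum_congr rfl fun a ha => ?_
  rw [sum_stringProd_zero, sum_stringProd_zero_sub N M a (by rw [mem_range] at ha; omega)]

theorem Ztilde_eq_sum (L N M : ℕ) :
    Ztilde L N M = ∑ a ∈ range (M + 1), binom L (N - 2 * a) * binom (L - N + 2 * a) a *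
        (binom (N - 2 * a) (M - a) - binom (N - 2 * a) (M - a - 1)) := by
  simp only [Ztilde, prod_eq_stringProd_zero, prod_eq_stringProd_one]
  rw [sum_configs]
  refine sum_congr rfl fun a ha => ?_
  rw [sum_stringProd_one, sum_stringProd_zero_sub N M a (by rw [mem_range] at ha; omega)]

/-- The summation formula behind both counts, for `i ≤ M`. -/
theorem sum_binom_config (L N M : ℕ) (i : ℤ) (hi : i ≤ M) :
    ∑ a ∈ range (M + 1), binom L (N - 2 * a) * binom (L - N + 2 * a) a * binom (N - 2 * a) (i - a) =
      binom L i * binom L (N - i) := by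
  rw [← sum_binom_mul_binom_mul_binom_of_lt L i (N - i) (M + 1) (by push_cast; omega)]
  refine sum_congr rfl fun a _ => ?_
  rw [add_sub_cancel, show (L : ℤ) - i - (N - i) + 2 * a = L - N + 2 * a by ring]
  ring

theorem sum_binom_config_pred (L N M : ℕ) (i : ℤ) (hi : i ≤ M) :
    ∑ a ∈ range (M + 1), binom L (N - 2 * a) * binom (L - N + 2 * a) (a - 1) *
        binom (N - 2 * a) (i - a) =
      binom L (i - 1) * binom L (N - i - 1) := by
  rw [sum_range_succ', binom_of_neg _ (by omega : ((0 : ℕ) : ℤ) - 1 < 0), mul_zero, zero_mul,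
    add_zero, ← sum_binom_mul_binom_mul_binom_of_lt L (i - 1) (N - i - 1) M (by omega)]
  refine sum_congr rfl fun a _ => ?_
  rw [Nat.cast_succ, add_sub_cancel_right,
    show i - 1 + (N - i - 1) - 2 * a = (N : ℤ) - 2 * (a + 1) by ring,
    show (L : ℤ) - (i - 1) - (N - i - 1) + 2 * a = L - N + 2 * (a + 1) by ring,
    show i - 1 - (a : ℤ) = i - (a + 1) by ring]
  ring

theorem binom_add_two (r k : ℤ) :
    binom (r + 2) k = binom r k + 2 * binom r (k - 1) + binom r (k - 2) := by
  rw [show r + 2 = r + 1 + 1 by ring, binom_pascal, binom_pascal, binom_pascal,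
    show k - 1 - 1 = k - 2 by ring]
  ring

theorem Z_eq_and_Ztilde_eq (L N M : ℕ) :
    Z L N M =
        binom ((L : ℤ) + 2) M * binom L ((N : ℤ) - M) -
          binom L ((M : ℤ) - 1) *
            binom ((L : ℤ) + 2) ((N : ℤ) - M + 1) ∧
      Ztilde L N M =
        binom L M * binom L ((N : ℤ) - M) -
          binom L ((M : ℤ) - 1) *
            binom L ((N : ℤ) - M + 1) := by
  have h1 := sum_binom_config L N M M le_rfl
  have h2 := sum_binom_config L N M (M - 1) (by omega)
  have h3 := sum_binom_config_pred L N M M le_rfl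
  have h4 := sum_binom_config_pred L N M (M - 1) (by omega)
  simp only [sub_right_comm (M : ℤ) 1] at h2 h4
  rw [show (N : ℤ) - (M - 1) = N - M + 1 by ring] at h2 h4
  rw [add_sub_cancel_right, show (M : ℤ) - 1 - 1 = M - 2 by ring] at h4
  constructor
  · rw [Z_eq_sum, binom_add_two, binom_add_two, add_sub_cancel_right,
      show (N : ℤ) - M + 1 - 2 = N - M - 1 by ring]
    simp only [mul_sub, sub_mul, sum_sub_distrib]
    rw [h1, h2, h3, h4]
    ring
  · rw [Ztilde_eq_sum]
    simp only [mul_sub, sum_sub_distrib]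
    rw [h1, h2]

end HubbardCount

theorem corollary2 (L N M : ℕ) :
    HubbardCount.Z L N M =
        HubbardCount.binom ((L : ℤ) + 2) M * HubbardCount.binom L ((N : ℤ) - M) -
          HubbardCount.binom L ((M : ℤ) - 1) *
            HubbardCount.binom ((L : ℤ) + 2) ((N : ℤ) - M + 1) ∧
      HubbardCount.Ztilde L N M =
        HubbardCount.binom L M * HubbardCount.binom L ((N : ℤ) - M) -
          HubbardCount.binom L ((M : ℤ) - 1) *
            HubbardCount.binom L ((N : ℤ) - M + 1) :=
  HubbardCount.Z_eq_and_Ztilde_eq L N M
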